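/- Let $T,\rho,r,\eta,\xi,p>0$, $\theta\in(0,1)$, $a_0\ge 0$, $x_0\in[0,1]$, $C>0$ and $Z$ be constants, and let $w\in C^2(\mathbb R)$ be such that $w$ and $w'$ are bounded, $w>0$ on $(0,1)$, $w<0$ outside $[0,1]$, $w'>0$ on $(-\infty,0]$ and $w'<0$ on $[1,\infty)$. With $\mu=\max_{t,t_0\in[0,T]}e^{(r-\rho)(t-t_0)}$, assume $$C^\theta>\max\bigl(1,\mu^{1/\theta}\bigr)\,\frac{a_0+T\sup_x|w(x)|}{p\,(1-e^{-rT})/r},\qquad Z>\frac{T\sup_x|w'(x)|\,e^{rT}}{2\xi}.$$ Admissible controls are pairs $(c,z)$ of measurable functions on $[0,T]$ with $0\le c\le C$ and $|z|\le Z$ whose absolutely continuous states, determined by $$\dot a=ra+w(x)-pc-\xi z^2,\quad \dot x=z\quad\text{a.e.},\qquad a(0)=a_0,\quad x(0)=x_0,$$ satisfy $a(T)\ge 0$. Let $(c,z)$, with states $(a,x)$, maximize $$J=\int_0^T e^{-\rho t}\Bigl(\frac{c(t)^{1-\theta}}{1-\theta}-\eta z(t)^2\Bigr)dt+e^{-\rho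 T}\frac{a(T)^{1-\theta}}{1-\theta}$$ over all admissible controls. Multipliers of the Pontryagin maximum principle for $(c,z,a,x)$ are a number $\lambda_0\in\{0,1\}$ and absolutely continuous costates $p_1,p_2$ on $[0,T]$, with $\lambda_0$, $p_1$, $p_2$ not all identically zero, such that $\dot p_1=-rp_1$ and $\dot p_2=-p_1w'(x)$ a.e.; $p_1(T)=\lambda_0e^{-\rho T}a(T)^{-\theta}$ and $p_2(T)=0$; and for almost every $t$ the point $(c(t),z(t))$ maximizes $$(\varphi,\psi)\mapsto p_1(t)\bigl(ra(t)+w(x(t))-p\varphi-\xi\psi^2\bigr)+p_2(t)\psi+\lambda_0e^{-\rho t}\Bigl(\frac{\varphi^{1-\theta}}{1-\theta}-\eta\psi^2\Bigr)$$ over $[0,C]\times[-Z,Z]$. Then $a(T)>0$, such multipliers exist, and for any of them, with $\lambda_1=p_1(0)$, the following hold. 1. $\lambda_1=e^{(r-\rho)T}a(T)^{-\theta}>0$, and for all $t\in[0,T]$ $$p_2(t)=\lambda_1\int_t^T w'(x(\tau))e^{-r\tau}\,d\tau.$$ 2. The optimal relocation speed is interior and given by the costate: for almost every $t\in[0,T]$,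 $$|z(t)|<Z\quad\text{and}\quad z(t)=\frac{p_2(t)}{2\,(\xi\lambda_1e^{-rt}+\eta e^{-\rho t})}.$$ 3. For every $t\in[0,T]$ the right-hand side of the last formula lies in $(-Z,Z)$, so $z$ agrees almost everywhere with a continuous control that is interior at every $t$. -/

import Mathlib

open MeasureTheory Set

/-- The data of the consumption and relocation problem. -/
structure RelocationModel where
  /-- length of the planning horizon -/
  T : ℝ
  /-- time discount rate -/
  ρ : ℝ
  /-- interest rate -/
  r : ℝ
  /-- subjective disutility of relocation -/
  η : ℝ
  /-- monetary cost of relocation -/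
  ξ : ℝ
  /-- price of a unit of consumption -/
  p : ℝ
  /-- utility parameter -/
  θ : ℝ
  /-- initial assets -/
  a₀ : ℝ
  /-- initial location -/
  x₀ : ℝ
  /-- cap on consumption -/
  C : ℝ
  /-- cap on the relocation speed -/
  Z : ℝ
  /-- location-dependent wage -/
  w : ℝ → ℝ

namespace RelocationModel

variable (M : RelocationModel)

/-- The number `μ`, the maximum of `exp ((r - ρ) (t - t₀))` over `t, t₀ ∈ [0, T]`. -/
noncomputable def mu : ℝ :=
  sSup ((fun q : ℝ × ℝ => Real.exp ((M.r - M.ρ) * (q.1 - q.2))) ''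
    (Icc 0 M.T ×ˢ Icc 0 M.T))

/-- The standing assumptions on the data. The maxima over the real line of `|w|` and `|w'|`
are suprema, finite by assumption. -/
structure StandingAssumptions : Prop where
  T_pos : 0 < M.T
  ρ_pos : 0 < M.ρ
  r_pos : 0 < M.r
  η_pos : 0 < M.η
  ξ_pos : 0 < M.ξ
  p_pos : 0 < M.p
  θ_mem : M.θ ∈ Ioo (0 : ℝ) 1
  a₀_nonneg : 0 ≤ M.a₀
  x₀_mem : M.x₀ ∈ Icc (0 : ℝ) 1
  C_pos : 0 < M.C
  w_smooth : ContDiff ℝ 2 M.w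
  w_bounded : BddAbove (range fun x => |M.w x|)
  w_deriv_bounded : BddAbove (range fun x => |deriv M.w x|)
  w_pos : ∀ x ∈ Ioo (0 : ℝ) 1, 0 < M.w x
  w_neg : ∀ x, x ∉ Icc (0 : ℝ) 1 → M.w x < 0
  w_deriv_pos : ∀ x ≤ 0, 0 < deriv M.w x
  w_deriv_neg : ∀ x, 1 ≤ x → deriv M.w x < 0
  C_large : max 1 (M.mu ^ (1 / M.θ)) *
      ((M.a₀ + M.T * ⨆ x, |M.w x|) / (M.p * ((1 - Real.exp (-(M.r * M.T))) / M.r)))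
    < M.C ^ M.θ
  Z_large : M.T * (⨆ x, |deriv M.w x|) * Real.exp (M.r * M.T) / (2 * M.ξ) < M.Z

/-- `(c, z)` is an admissible pair of controls on `[0, T]`, and `(a, x)` is the corresponding
absolutely continuous state trajectory. -/
structure IsAdmissible (c z a x : ℝ → ℝ) : Prop where
  c_meas : AEMeasurable c (volume.restrict (Icc 0 M.T))
  z_meas : AEMeasurable z (volume.restrict (Icc 0 M.T))
  c_mem : ∀ t ∈ Icc 0 M.T, 0 ≤ c t ∧ c t ≤ M.C
  z_mem : ∀ t ∈ Icc 0 M.T, |z t| ≤ M.Z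
  a_ac : AbsolutelyContinuousOnInterval a 0 M.T
  x_ac : AbsolutelyContinuousOnInterval x 0 M.T
  a_deriv : ∀ᵐ t ∂(volume.restrict (Icc 0 M.T)),
    HasDerivAt a (M.r * a t + M.w (x t) - M.p * c t - M.ξ * z t ^ 2) t
  x_deriv : ∀ᵐ t ∂(volume.restrict (Icc 0 M.T)), HasDerivAt x (z t) t
  a_init : a 0 = M.a₀
  x_init : x 0 = M.x₀
  a_final : 0 ≤ a M.T

/-- The objective functional. -/
noncomputable def objective (c z a : ℝ → ℝ) : ℝ :=
  (∫ t in (0 : ℝ)..M.T,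
      Real.exp (-(M.ρ * t)) * (c t ^ (1 - M.θ) / (1 - M.θ) - M.η * z t ^ 2))
    + Real.exp (-(M.ρ * M.T)) * (a M.T ^ (1 - M.θ) / (1 - M.θ))

/-- `(c, z)`, with states `(a, x)`, solves the optimal control problem: it maximizes the
objective functional among all admissible controls. -/
structure IsOptimal (c z a x : ℝ → ℝ) : Prop where
  admissible : M.IsAdmissible c z a x
  maximal : ∀ c' z' a' x' : ℝ → ℝ, M.IsAdmissible c' z' a' x' →
    M.objective c' z' a' ≤ M.objective c z a

/-- The Hamiltonian at time `t`, states `a, x`, control values `φ, ψ`, costates `p₁, p₂` and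
utility multiplier `lam₀`. -/
noncomputable def hamiltonian (lam₀ t a x φ ψ p₁ p₂ : ℝ) : ℝ :=
  p₁ * (M.r * a + M.w x - M.p * φ - M.ξ * ψ ^ 2) + p₂ * ψ
    + lam₀ * Real.exp (-(M.ρ * t)) * (φ ^ (1 - M.θ) / (1 - M.θ) - M.η * ψ ^ 2)

/-- `lam₀ ∈ {0, 1}` and the costates `p₁, p₂` satisfy the Pontryagin maximum principle along
the process `(c, z, a, x)`: costate equations, maximum condition, transversality at `T`, and
nontriviality. -/
structure IsMultiplier (c z a x : ℝ → ℝ) (lam₀ : ℝ) (p₁ p₂ : ℝ → ℝ) : Prop where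
  lam₀_mem : lam₀ = 0 ∨ lam₀ = 1
  p₁_ac : AbsolutelyContinuousOnInterval p₁ 0 M.T
  p₂_ac : AbsolutelyContinuousOnInterval p₂ 0 M.T
  p₁_deriv : ∀ᵐ t ∂(volume.restrict (Icc 0 M.T)), HasDerivAt p₁ (-(M.r * p₁ t)) t
  p₂_deriv : ∀ᵐ t ∂(volume.restrict (Icc 0 M.T)),
    HasDerivAt p₂ (-(p₁ t * deriv M.w (x t))) t
  max_cond : ∀ᵐ t ∂(volume.restrict (Icc 0 M.T)),
    ∀ φ ∈ Icc 0 M.C, ∀ ψ ∈ Icc (-M.Z) M.Z,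
      M.hamiltonian lam₀ t (a t) (x t) φ ψ (p₁ t) (p₂ t)
        ≤ M.hamiltonian lam₀ t (a t) (x t) (c t) (z t) (p₁ t) (p₂ t)
  p₁_final : p₁ M.T = lam₀ * (Real.exp (-(M.ρ * M.T)) * a M.T ^ (-M.θ))
  p₂_final : p₂ M.T = 0
  nontrivial : ¬ (lam₀ = 0 ∧ ∀ t ∈ Icc 0 M.T, p₁ t = 0 ∧ p₂ t = 0)

end RelocationModel

/-! The maximum principle is proved directly, by varying the control pair along segments. The state
equations integrate explicitly, so the payoff depends on the controls alone and the only state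
constraint is the sign of the terminal assets. The control set is convex, the running utility is
concave, and consumption and moving cost enter savings concavely. Only `w` is not concave, and its
Taylor error along a segment is `O(ε²)`. Hence convex combinations with any competitor give
first-order conditions, and needle variations are not needed.

If `a(T) = 0`, the infinite marginal utility of terminal assets forbids any direction that raises
them to first order. Consuming less is such a direction, so consumption vanishes a.e. and the payoff
is at most `0`. Then staying put without consuming is also optimal and also ends with zero assets,
which forces `w(x₀) = 0`. There `w' ≠ 0`, so a slow move in the right direction raises assets, a
contradiction (`terminal_assets_pos`).

If `a(T) > 0`, the competitor is the explicit pointwise maximizer of the normal Hamiltonian.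
Integration by parts turns the first-order condition into: the integral of a nonnegative Hamiltonian
gap is at most `0`. So the gap vanishes a.e. (`ae_hamiltonian_eq`), and multipliers exist.

Conversely, the linear costate equations determine all multipliers up to `p₁(0)`. Nontriviality
excludes `λ₀ = 0`, and completing the square in the speed gives the formula. The bound on `Z` makes
it interior. -/

open Filter Topology

/-! ### Real analysis: absolute continuity, Taylor bounds, power utility -/

/-- An absolutely continuous function is the integral of its almost everywhere derivative. -/
theorem AbsolutelyContinuousOnInterval.integral_eq_sub_of_ae_hasDerivAt {f g : ℝ → ℝ} {a b : ℝ}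
    (hab : a ≤ b) (hf : AbsolutelyContinuousOnInterval f a b)
    (hd : ∀ᵐ t ∂(volume.restrict (Icc a b)), HasDerivAt f (g t) t) {s t : ℝ}
    (hs : s ∈ Icc a b) (ht : t ∈ Icc a b) : ∫ τ in s..t, g τ = f t - f s := by
  have hsub : uIcc s t ⊆ Icc a b := ordConnected_Icc.uIcc_subset hs ht
  rw [← (hf.mono (by rwa [uIcc_of_le hab])).integral_deriv_eq_sub]
  refine intervalIntegral.integral_congr_ae ?_
  filter_upwards [(ae_restrict_iff' measurableSet_Icc).1 hd] with τ hτ hτ'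
  exact (hτ (hsub (uIoc_subset_uIcc hτ'))).deriv.symm

theorem intervalIntegrable_of_abs_le {f : ℝ → ℝ} {a b B : ℝ} (hab : a ≤ b)
    (hf : AEMeasurable f (volume.restrict (Icc a b))) (hB : ∀ t ∈ Icc a b, |f t| ≤ B) :
    IntervalIntegrable f volume a b := by
  rw [intervalIntegrable_iff_integrableOn_Icc_of_le hab]
  refine Integrable.of_bound hf.aestronglyMeasurable B ?_
  exact (ae_restrict_iff' measurableSet_Icc).2 (Eventually.of_forall hB)

theorem ae_hasDerivAt_intervalIntegral {f : ℝ → ℝ} {a b c : ℝ} (hab : a ≤ b)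
    (hf : IntervalIntegrable f volume a b) (hc : c ∈ Icc a b) :
    ∀ᵐ t ∂(volume.restrict (Icc a b)), HasDerivAt (fun t => ∫ τ in c..t, f τ) (f t) t := by
  rw [ae_restrict_iff' measurableSet_Icc]
  filter_upwards [hf.ae_hasDerivAt_integral] with t ht ht'
  rw [uIcc_of_le hab] at ht
  exact ht ht' c hc

theorem absolutelyContinuousOnInterval_of_contDiff {f : ℝ → ℝ} {a b : ℝ} (hf : ContDiff ℝ 1 f) :
    AbsolutelyContinuousOnInterval f a b :=
  hf.contDiffOn.absolutelyContinuousOnInterval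

/-- Second order Taylor lower bound, uniform on bounded intervals. -/
theorem ContDiff.exists_taylor_lower_bound {f : ℝ → ℝ} (hf : ContDiff ℝ 2 f) (R : ℝ) :
    ∃ K, 0 ≤ K ∧ ∀ u ∈ Icc (-R) R, ∀ v ∈ Icc (-R) R,
      f u + deriv f u * (v - u) - K * (v - u) ^ 2 ≤ f v := by
  have hf1 : ContDiff ℝ 1 (deriv f) := ((contDiff_succ_iff_deriv (n := 1)).1 hf).2.2
  obtain ⟨K, hK⟩ := hf1.contDiffOn.exists_lipschitzOnWith (s := Icc (-R) R) (by decide)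
    (convex_Icc _ _) isCompact_Icc
  refine ⟨K, K.2, fun u hu v hv => ?_⟩
  have hdiff : Differentiable ℝ f := hf.differentiable (by decide)
  -- The mean value point is no farther from `u` than `v` is, so the Lipschitz bound on `f'` costs
  -- at most `K (v - u) ^ 2`.
  have key : ∃ m ∈ Icc (-R) R, |m - u| ≤ |v - u| ∧ f v - f u = deriv f m * (v - u) := by
    rcases lt_trichotomy u v with h | h | h
    · obtain ⟨m, hm, he⟩ := exists_deriv_eq_slope f h hdiff.continuous.continuousOn
        hdiff.differentiableOn
      refine ⟨m, ⟨by linarith [hu.1, hm.1], by linarith [hv.2, hm.2]⟩, ?_, ?_⟩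
      · rw [abs_of_pos (by linarith [hm.1]), abs_of_pos (by linarith)]; linarith [hm.2]
      · rw [he, div_mul_cancel₀ _ (by linarith)]
    · exact ⟨u, hu, by simp, by simp [h]⟩
    · obtain ⟨m, hm, he⟩ := exists_deriv_eq_slope f h hdiff.continuous.continuousOn
        hdiff.differentiableOn
      refine ⟨m, ⟨by linarith [hv.1, hm.1], by linarith [hu.2, hm.2]⟩, ?_, ?_⟩
      · rw [abs_of_neg (by linarith [hm.2]), abs_of_neg (by linarith)]; linarith [hm.1]
      · have : (f u - f v) / (u - v) * (u - v) = f u - f v := div_mul_cancel₀ _ (by linarith)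
        rw [he]; linarith
  obtain ⟨m, hm, hmu, he⟩ := key
  have hl := hK.dist_le_mul m hm u hu
  rw [Real.dist_eq, Real.dist_eq] at hl
  have h1 : |deriv f m - deriv f u| * |v - u| ≤ K * |v - u| * |v - u| := by
    gcongr
    exact hl.trans (by gcongr)
  rw [← abs_mul, mul_assoc, abs_mul_abs_self] at h1
  nlinarith [neg_abs_le ((deriv f m - deriv f u) * (v - u))]

/-- The power utility lies below its tangent lines. -/
theorem Real.rpow_div_le_tangent {s x y : ℝ} (hs : 0 < s) (hs1 : s ≤ 1) (hx : 0 ≤ x)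
    (hy : 0 < y) : x ^ s / s ≤ y ^ s / s + y ^ (s - 1) * (x - y) := by
  -- Bernoulli's inequality for an exponent in `(0, 1]`, applied to the relative change from `y` to
  -- `x`.
  have h := rpow_one_add_le_one_add_mul_self (s := (x - y) / y)
    (by rw [le_div_iff₀ hy]; linarith) hs.le hs1
  have e : 1 + (x - y) / y = x / y := by field_simp; ring
  rw [e, Real.div_rpow hx hy.le, div_le_iff₀ (by positivity)] at h
  rw [Real.rpow_sub_one hy.ne']
  have : x ^ s / s ≤ ((1 + s * ((x - y) / y)) * y ^ s) / s := by gcongr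
  refine this.trans (le_of_eq ?_)
  field_simp

/-- The objective is concave with critical point `k ^ (-(1 / θ))`, so truncating that point at the
cap gives the maximizer; the tangent line there proves it. -/
theorem Real.rpow_div_le_of_min {θ C k φ : ℝ} (hθ : θ ∈ Ioo (0 : ℝ) 1) (hC : 0 < C) (hk : 0 < k)
    (hφ : φ ∈ Icc 0 C) :
    φ ^ (1 - θ) / (1 - θ) - k * φ
      ≤ min C (k ^ (-(1 / θ))) ^ (1 - θ) / (1 - θ) - k * min C (k ^ (-(1 / θ))) := by
  have hk' : 0 < k ^ (-(1 / θ)) := Real.rpow_pos_of_pos hk _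
  set m := min C (k ^ (-(1 / θ))) with hm
  have hm0 : 0 < m := lt_min hC hk'
  have h := Real.rpow_div_le_tangent (s := 1 - θ) (by linarith [hθ.2]) (by linarith [hθ.1])
    hφ.1 hm0
  have hpow : (k ^ (-(1 / θ))) ^ (1 - θ - 1) = k := by
    rw [← Real.rpow_mul hk.le]
    have : -(1 / θ) * (1 - θ - 1) = 1 := by have := hθ.1.ne'; field_simp; ring
    rw [this, Real.rpow_one]
  -- The slope at `m` equals `k` unless the cap binds; then it is at least `k`, while `φ - m ≤ 0`.
  have h2 : m ^ (1 - θ - 1) * (φ - m) ≤ k * (φ - m) := by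
    rcases le_total C (k ^ (-(1 / θ))) with hle | hle
    · have hmC : m = C := min_eq_left hle
      have : k ≤ m ^ (1 - θ - 1) := by
        rw [← hpow, hmC]
        exact Real.rpow_le_rpow_of_nonpos hC hle (by linarith [hθ.1])
      have h3 : φ - m ≤ 0 := by rw [hmC]; linarith [hφ.2]
      nlinarith
    · have hmC : m = k ^ (-(1 / θ)) := min_eq_right hle
      rw [hmC, hpow]
  linarith

/-! ### States and payoff as functions of the controls -/

namespace RelocationModel

variable {M : RelocationModel} {c z a x v₁ v₂ : ℝ → ℝ}

/-- `(c, z)` is a pair of measurable controls obeying the caps. -/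
structure IsControl (M : RelocationModel) (c z : ℝ → ℝ) : Prop where
  c_meas : AEMeasurable c (volume.restrict (Icc 0 M.T))
  z_meas : AEMeasurable z (volume.restrict (Icc 0 M.T))
  c_mem : ∀ t ∈ Icc 0 M.T, 0 ≤ c t ∧ c t ≤ M.C
  z_mem : ∀ t ∈ Icc 0 M.T, |z t| ≤ M.Z

theorem IsAdmissible.isControl (h : M.IsAdmissible c z a x) : M.IsControl c z :=
  ⟨h.c_meas, h.z_meas, h.c_mem, h.z_mem⟩

/-- The location reached with relocation speed `z`. -/
noncomputable def location (M : RelocationModel) (z : ℝ → ℝ) (t : ℝ) : ℝ :=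
  M.x₀ + ∫ τ in (0 : ℝ)..t, z τ

/-- Discounted net saving. -/
noncomputable def saving (M : RelocationModel) (c z : ℝ → ℝ) (t : ℝ) : ℝ :=
  Real.exp (-(M.r * t)) * (M.w (M.location z t) - M.p * c t - M.ξ * z t ^ 2)

/-- The assets accumulated with the controls `(c, z)`. -/
noncomputable def assets (M : RelocationModel) (c z : ℝ → ℝ) (t : ℝ) : ℝ :=
  Real.exp (M.r * t) * (M.a₀ + ∫ τ in (0 : ℝ)..t, M.saving c z τ)

theorem StandingAssumptions.abs_deriv_w_le (hM : M.StandingAssumptions) (y : ℝ) :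
    |deriv M.w y| ≤ ⨆ y, |deriv M.w y| := le_ciSup hM.w_deriv_bounded y

theorem StandingAssumptions.continuous_w (hM : M.StandingAssumptions) : Continuous M.w :=
  hM.w_smooth.continuous

theorem StandingAssumptions.continuous_deriv_w (hM : M.StandingAssumptions) :
    Continuous (deriv M.w) := hM.w_smooth.continuous_deriv (by decide)

theorem StandingAssumptions.Z_pos (hM : M.StandingAssumptions) : 0 < M.Z := by
  refine lt_of_le_of_lt ?_ hM.Z_large
  have := hM.T_pos
  have := hM.ξ_pos
  have := (abs_nonneg _).trans (hM.abs_deriv_w_le 0)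
  positivity

theorem StandingAssumptions.zero_mem (hM : M.StandingAssumptions) : (0 : ℝ) ∈ Icc 0 M.T :=
  ⟨le_rfl, hM.T_pos.le⟩

theorem StandingAssumptions.T_mem (hM : M.StandingAssumptions) : M.T ∈ Icc 0 M.T :=
  ⟨hM.T_pos.le, le_rfl⟩

theorem IsControl.abs_c_le (h : M.IsControl c z) : ∀ t ∈ Icc 0 M.T, |c t| ≤ M.C :=
  fun t ht => by rw [abs_of_nonneg (h.c_mem t ht).1]; exact (h.c_mem t ht).2

theorem IsControl.z_sq_le (h : M.IsControl c z) : ∀ t ∈ Icc 0 M.T, z t ^ 2 ≤ M.Z ^ 2 :=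
  fun t ht => sq_le_sq' (neg_le_of_abs_le (h.z_mem t ht)) (le_of_abs_le (h.z_mem t ht))

theorem IsControl.intervalIntegrable_c (hM : M.StandingAssumptions) (h : M.IsControl c z) :
    IntervalIntegrable c volume 0 M.T :=
  intervalIntegrable_of_abs_le hM.T_pos.le h.c_meas h.abs_c_le

theorem IsControl.intervalIntegrable_z (hM : M.StandingAssumptions) (h : M.IsControl c z) :
    IntervalIntegrable z volume 0 M.T :=
  intervalIntegrable_of_abs_le hM.T_pos.le h.z_meas h.z_mem

theorem IsControl.intervalIntegrable_z_sq (hM : M.StandingAssumptions) (h : M.IsControl c z) :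
    IntervalIntegrable (fun t => z t ^ 2) volume 0 M.T :=
  intervalIntegrable_of_abs_le (B := M.Z ^ 2) hM.T_pos.le (h.z_meas.pow_const 2)
    fun t ht => by rw [abs_of_nonneg (sq_nonneg _)]; exact h.z_sq_le t ht

theorem IsControl.intervalIntegrable_utility (hM : M.StandingAssumptions) (h : M.IsControl c z) :
    IntervalIntegrable (fun t => c t ^ (1 - M.θ) / (1 - M.θ)) volume 0 M.T := by
  refine (intervalIntegrable_of_abs_le (B := M.C ^ (1 - M.θ)) hM.T_pos.le
    (h.c_meas.pow_const _) fun t ht => ?_).div_const _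
  have h0 := h.c_mem t ht
  rw [abs_of_nonneg (Real.rpow_nonneg h0.1 _)]
  exact Real.rpow_le_rpow h0.1 h0.2 (by linarith [hM.θ_mem.2])

theorem absolutelyContinuous_location
    (h : IntervalIntegrable z volume 0 M.T) :
    AbsolutelyContinuousOnInterval (M.location z) 0 M.T := by
  have h1 : AbsolutelyContinuousOnInterval (fun _ : ℝ => M.x₀) 0 M.T :=
    absolutelyContinuousOnInterval_of_contDiff contDiff_const
  exact h1.fun_add (h.absolutelyContinuousOnInterval_intervalIntegral (by simp))

theorem continuousOn_location (hM : M.StandingAssumptions)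
    (h : IntervalIntegrable z volume 0 M.T) : ContinuousOn (M.location z) (Icc 0 M.T) := by
  simpa [uIcc_of_le hM.T_pos.le] using (absolutelyContinuous_location h).continuousOn

theorem IsControl.intervalIntegrable_saving (hM : M.StandingAssumptions) (h : M.IsControl c z) :
    IntervalIntegrable (M.saving c z) volume 0 M.T := by
  have hw : ContinuousOn (fun t => M.w (M.location z t)) (uIcc 0 M.T) := by
    rw [uIcc_of_le hM.T_pos.le]
    exact hM.continuous_w.comp_continuousOn (continuousOn_location hM (h.intervalIntegrable_z hM))
  refine IntervalIntegrable.continuousOn_mul (((hw.intervalIntegrable).sub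
    ((h.intervalIntegrable_c hM).const_mul _)).sub
    ((h.intervalIntegrable_z_sq hM).const_mul _)) ?_
  fun_prop

/-- Variation of constants solves the state equations for every control pair, so admissibility
reduces to one scalar inequality at `T`. -/
theorem IsControl.isAdmissible (hM : M.StandingAssumptions) (h : M.IsControl c z)
    (hT : 0 ≤ M.assets c z M.T) : M.IsAdmissible c z (M.assets c z) (M.location z) where
  c_meas := h.c_meas
  z_meas := h.z_meas
  c_mem := h.c_mem
  z_mem := h.z_mem
  a_ac := by
    have h1 : AbsolutelyContinuousOnInterval (fun _ : ℝ => M.a₀) 0 M.T :=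
      absolutelyContinuousOnInterval_of_contDiff contDiff_const
    have h2 : AbsolutelyContinuousOnInterval (fun t : ℝ => Real.exp (M.r * t)) 0 M.T :=
      absolutelyContinuousOnInterval_of_contDiff (by fun_prop)
    exact h2.fun_mul (h1.fun_add ((h.intervalIntegrable_saving
      hM).absolutelyContinuousOnInterval_intervalIntegral (by simp)))
  x_ac := absolutelyContinuous_location (h.intervalIntegrable_z hM)
  a_deriv := by
    filter_upwards [ae_hasDerivAt_intervalIntegral hM.T_pos.le (h.intervalIntegrable_saving hM)
      hM.zero_mem] with t ht
    have h2 : HasDerivAt (fun t : ℝ => Real.exp (M.r * t)) (Real.exp (M.r * t) * M.r) t := by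
      simpa using ((hasDerivAt_id t).const_mul M.r).exp
    refine (h2.mul (ht.const_add M.a₀)).congr_deriv ?_
    have he : Real.exp (M.r * t) * Real.exp (-(M.r * t)) = 1 := by
      rw [← Real.exp_add]; simp
    simp only [assets, saving]
    linear_combination (M.w (M.location z t) - M.p * c t - M.ξ * z t ^ 2) * he
  x_deriv := by
    filter_upwards [ae_hasDerivAt_intervalIntegral hM.T_pos.le (h.intervalIntegrable_z hM)
      hM.zero_mem] with t ht
    exact ht.const_add M.x₀
  a_init := by simp [assets]
  x_init := by simp [location]
  a_final := hT

theorem IsAdmissible.location_eq (hM : M.StandingAssumptions) (h : M.IsAdmissible c z a x) {t : ℝ}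
    (ht : t ∈ Icc 0 M.T) : M.location z t = x t := by
  rw [location, h.x_ac.integral_eq_sub_of_ae_hasDerivAt hM.T_pos.le h.x_deriv hM.zero_mem ht,
    h.x_init]
  ring

/-- The integrating factor `exp (-(r t))` shows that the state equation determines the terminal
assets, so the objective may be studied as `payoff`. -/
theorem IsAdmissible.assets_eq (hM : M.StandingAssumptions) (h : M.IsAdmissible c z a x) :
    M.assets c z M.T = a M.T := by
  have h2 : AbsolutelyContinuousOnInterval (fun t : ℝ => Real.exp (-(M.r * t))) 0 M.T :=
    absolutelyContinuousOnInterval_of_contDiff (by fun_prop)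
  have hd : ∀ᵐ t ∂(volume.restrict (Icc 0 M.T)),
      HasDerivAt (fun t => Real.exp (-(M.r * t)) * a t) (M.saving c z t) t := by
    filter_upwards [h.a_deriv, ae_restrict_mem measurableSet_Icc] with t ht hmem
    have h2 : HasDerivAt (fun t : ℝ => Real.exp (-(M.r * t)))
        (Real.exp (-(M.r * t)) * (-M.r)) t := by
      simpa using ((hasDerivAt_id t).const_mul M.r).neg.exp
    refine (h2.mul ht).congr_deriv ?_
    rw [saving, h.location_eq hM hmem]
    ring
  rw [assets, (h2.fun_mul h.a_ac).integral_eq_sub_of_ae_hasDerivAt hM.T_pos.le hd hM.zero_mem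
    hM.T_mem, h.a_init]
  have he : Real.exp (M.r * M.T) * Real.exp (-(M.r * M.T)) = 1 := by
    rw [← Real.exp_add]; simp
  simp only [mul_zero, neg_zero, Real.exp_zero]
  linear_combination (a M.T) * he

/-- The payoff of a pair of controls, as a function of the controls alone. -/
noncomputable def payoff (M : RelocationModel) (c z : ℝ → ℝ) : ℝ := M.objective c z (M.assets c z)

theorem IsAdmissible.payoff_eq (hM : M.StandingAssumptions) (h : M.IsAdmissible c z a x) :
    M.payoff c z = M.objective c z a := by
  rw [payoff, objective, objective, h.assets_eq hM]

theorem IsOptimal.payoff_le (hM : M.StandingAssumptions) (h : M.IsOptimal c z a x)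
    {c' z' : ℝ → ℝ} (h' : M.IsControl c' z') (hT : 0 ≤ M.assets c' z' M.T) :
    M.payoff c' z' ≤ M.payoff c z := by
  rw [h.admissible.payoff_eq hM]
  exact h.maximal _ _ _ _ (h'.isAdmissible hM hT)

/-! ### First variation along segments of controls -/

/-- Integrand of the first variation of the discounted terminal assets in the direction from
`(c, z)` to `(v₁, v₂)`. -/
noncomputable def savingVariation (M : RelocationModel) (c z v₁ v₂ : ℝ → ℝ) (t : ℝ) : ℝ :=
  Real.exp (-(M.r * t)) * (deriv M.w (M.location z t) * (∫ τ in (0 : ℝ)..t, (v₂ τ - z τ))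
    - M.p * (v₁ t - c t) - M.ξ * (v₂ t ^ 2 - z t ^ 2))

/-- Discounted flow utility. -/
noncomputable def flowUtility (M : RelocationModel) (c z : ℝ → ℝ) (t : ℝ) : ℝ :=
  Real.exp (-(M.ρ * t)) * (c t ^ (1 - M.θ) / (1 - M.θ) - M.η * z t ^ 2)

theorem payoff_eq_add : M.payoff c z = (∫ t in (0 : ℝ)..M.T, M.flowUtility c z t)
    + Real.exp (-(M.ρ * M.T)) * (M.assets c z M.T ^ (1 - M.θ) / (1 - M.θ)) := rfl

theorem IsControl.mix (h : M.IsControl c z) (hv : M.IsControl v₁ v₂) {ε : ℝ}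
    (hε : ε ∈ Icc (0 : ℝ) 1) :
    M.IsControl (fun t => c t + ε * (v₁ t - c t)) (fun t => z t + ε * (v₂ t - z t)) where
  c_meas := h.c_meas.add ((hv.c_meas.sub h.c_meas).const_mul ε)
  z_meas := h.z_meas.add ((hv.z_meas.sub h.z_meas).const_mul ε)
  c_mem t ht := by
    have h1 := h.c_mem t ht
    have h2 := hv.c_mem t ht
    constructor <;> nlinarith [hε.1, hε.2, mul_nonneg hε.1 h2.1,
      mul_nonneg (sub_nonneg.2 hε.2) h1.1, mul_nonneg hε.1 (sub_nonneg.2 h2.2),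
      mul_nonneg (sub_nonneg.2 hε.2) (sub_nonneg.2 h1.2)]
  z_mem t ht := by
    have h1 := abs_le.1 (h.z_mem t ht)
    have h2 := abs_le.1 (hv.z_mem t ht)
    rw [abs_le]
    constructor <;> nlinarith [hε.1, hε.2, mul_nonneg hε.1 (sub_nonneg.2 h2.1),
      mul_nonneg (sub_nonneg.2 hε.2) (sub_nonneg.2 h1.1), mul_nonneg hε.1 (sub_nonneg.2 h2.2),
      mul_nonneg (sub_nonneg.2 hε.2) (sub_nonneg.2 h1.2)]

theorem IsControl.intervalIntegrable_flowUtility (hM : M.StandingAssumptions)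
    (h : M.IsControl c z) : IntervalIntegrable (M.flowUtility c z) volume 0 M.T := by
  refine IntervalIntegrable.continuousOn_mul ((h.intervalIntegrable_utility hM).sub
    ((h.intervalIntegrable_z_sq hM).const_mul _)) ?_
  fun_prop

theorem IsControl.continuousOn_displacement (hM : M.StandingAssumptions) (h : M.IsControl c z)
    (hv : M.IsControl v₁ v₂) :
    ContinuousOn (fun t => ∫ τ in (0 : ℝ)..t, (v₂ τ - z τ)) (Icc 0 M.T) := by
  have := (((hv.intervalIntegrable_z hM).sub (h.intervalIntegrable_z
    hM)).absolutelyContinuousOnInterval_intervalIntegral (c := 0) (by simp)).continuousOn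
  simpa [uIcc_of_le hM.T_pos.le] using this

theorem IsControl.abs_displacement_le (h : M.IsControl c z)
    (hv : M.IsControl v₁ v₂) {t : ℝ} (ht : t ∈ Icc 0 M.T) :
    |∫ τ in (0 : ℝ)..t, (v₂ τ - z τ)| ≤ 2 * M.Z * M.T := by
  have hb : ∀ τ ∈ uIoc 0 t, ‖v₂ τ - z τ‖ ≤ 2 * M.Z := by
    intro τ hτ
    rw [uIoc_of_le ht.1] at hτ
    have hτ' : τ ∈ Icc 0 M.T := ⟨hτ.1.le, hτ.2.trans ht.2⟩
    have h1 := h.z_mem τ hτ'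
    have h2 := hv.z_mem τ hτ'
    rw [Real.norm_eq_abs]
    linarith [abs_sub (v₂ τ) (z τ)]
  have h1 := intervalIntegral.norm_integral_le_of_norm_le_const hb
  have hZ : 0 ≤ M.Z := (abs_nonneg _).trans (h.z_mem t ht)
  rw [Real.norm_eq_abs, sub_zero, abs_of_nonneg ht.1] at h1
  exact h1.trans (by have := ht.2; gcongr)

theorem IsControl.location_mix (hM : M.StandingAssumptions) (h : M.IsControl c z)
    (hv : M.IsControl v₁ v₂) (ε : ℝ) {t : ℝ} (ht : t ∈ Icc 0 M.T) :
    M.location (fun t => z t + ε * (v₂ t - z t)) t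
      = M.location z t + ε * ∫ τ in (0 : ℝ)..t, (v₂ τ - z τ) := by
  have hsub : uIcc 0 t ⊆ uIcc 0 M.T := by
    rw [uIcc_of_le hM.T_pos.le, uIcc_of_le ht.1]; exact Icc_subset_Icc_right ht.2
  have h1 := (h.intervalIntegrable_z hM).mono_set hsub
  have h2 := (hv.intervalIntegrable_z hM).mono_set hsub
  rw [location, location, intervalIntegral.integral_add h1 ((h2.sub h1).const_mul ε),
    intervalIntegral.integral_const_mul]
  ring

theorem IsControl.intervalIntegrable_savingVariation (hM : M.StandingAssumptions)
    (h : M.IsControl c z) (hv : M.IsControl v₁ v₂) :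
    IntervalIntegrable (M.savingVariation c z v₁ v₂) volume 0 M.T := by
  have hw : ContinuousOn (fun t => deriv M.w (M.location z t) *
      ∫ τ in (0 : ℝ)..t, (v₂ τ - z τ)) (uIcc 0 M.T) := by
    rw [uIcc_of_le hM.T_pos.le]
    exact (hM.continuous_deriv_w.comp_continuousOn
      (continuousOn_location hM (h.intervalIntegrable_z hM))).mul
      (h.continuousOn_displacement hM hv)
  refine IntervalIntegrable.continuousOn_mul (((hw.intervalIntegrable).sub
    (((hv.intervalIntegrable_c hM).sub (h.intervalIntegrable_c hM)).const_mul _)).sub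
    (((hv.intervalIntegrable_z_sq hM).sub (h.intervalIntegrable_z_sq hM)).const_mul _)) ?_
  fun_prop

/-- A one-sided bound suffices, since the payoff increases with terminal assets. Consumption is
linear and `-ξ z²` concave along the segment, so only `w` produces the quadratic error, with `K`
independent of `ε`. -/
theorem IsControl.exists_assets_mix_ge (hM : M.StandingAssumptions) (h : M.IsControl c z)
    (hv : M.IsControl v₁ v₂) :
    ∃ K, ∀ ε ∈ Icc (0 : ℝ) 1,
      M.assets c z M.T
        + ε * (Real.exp (M.r * M.T) * ∫ t in (0 : ℝ)..M.T, M.savingVariation c z v₁ v₂ t)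
        - K * ε ^ 2
      ≤ M.assets (fun t => c t + ε * (v₁ t - c t)) (fun t => z t + ε * (v₂ t - z t)) M.T := by
  have hZ := hM.Z_pos
  have hTp := hM.T_pos
  obtain ⟨B, hB⟩ := isCompact_Icc.exists_bound_of_continuousOn
    (continuousOn_location hM (h.intervalIntegrable_z hM))
  set D := 2 * M.Z * M.T with hD
  have hD0 : 0 ≤ D := by positivity
  -- `B` bounds the location and `D` its displacement, so every perturbed location stays in `[-(B +
  -- D), B + D]`.
  obtain ⟨K, hK0, hK⟩ := hM.w_smooth.exists_taylor_lower_bound (B + D)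
  refine ⟨Real.exp (M.r * M.T) * (M.T * (K * D ^ 2)), fun ε hε => ?_⟩
  have hpt : ∀ t ∈ Icc 0 M.T,
      M.saving c z t + ε * M.savingVariation c z v₁ v₂ t - K * D ^ 2 * ε ^ 2
      ≤ M.saving (fun t => c t + ε * (v₁ t - c t)) (fun t => z t + ε * (v₂ t - z t)) t := by
    intro t ht
    have hloc := h.location_mix hM hv ε ht
    have hy := h.abs_displacement_le hv ht
    have hx := hB t ht
    simp only [saving, savingVariation, hloc]
    set y := ∫ τ in (0 : ℝ)..t, (v₂ τ - z τ)
    set X := M.location z t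
    rw [Real.norm_eq_abs] at hx
    have hεy : |ε * y| ≤ D := by
      rw [abs_mul, abs_of_nonneg hε.1]
      nlinarith [hε.2, abs_nonneg y]
    have hx' := abs_le.1 hx
    have hy' := abs_le.1 hεy
    have hT := hK X ⟨by linarith, by linarith⟩ (X + ε * y) ⟨by linarith, by linarith⟩
    have e1 : X + ε * y - X = ε * y := by ring
    rw [e1] at hT
    have hy2 : y ^ 2 ≤ D ^ 2 := sq_le_sq' (abs_le.1 hy).1 (abs_le.1 hy).2
    have hKy : K * (ε * y) ^ 2 ≤ K * D ^ 2 * ε ^ 2 := by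
      rw [mul_pow, mul_assoc, mul_comm (D ^ 2)]
      gcongr
    have hz2 : (z t + ε * (v₂ t - z t)) ^ 2 ≤ z t ^ 2 + ε * (v₂ t ^ 2 - z t ^ 2) := by
      nlinarith [mul_nonneg (mul_nonneg hε.1 (sub_nonneg.2 hε.2)) (sq_nonneg (v₂ t - z t))]
    have hz3 := mul_le_mul_of_nonneg_left hz2 hM.ξ_pos.le
    have hexp : Real.exp (-(M.r * t)) ≤ 1 :=
      Real.exp_le_one_iff.2 (neg_nonpos.2 (mul_nonneg hM.r_pos.le ht.1))
    have hKe : Real.exp (-(M.r * t)) * (K * D ^ 2 * ε ^ 2) ≤ K * D ^ 2 * ε ^ 2 :=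
      mul_le_of_le_one_left (by positivity) hexp
    have hmain := mul_le_mul_of_nonneg_left (a := Real.exp (-(M.r * t)))
      (b := M.w X - M.p * c t - M.ξ * z t ^ 2 + ε * (deriv M.w X * y - M.p * (v₁ t - c t)
        - M.ξ * (v₂ t ^ 2 - z t ^ 2)) - K * D ^ 2 * ε ^ 2)
      (c := M.w (X + ε * y) - M.p * (c t + ε * (v₁ t - c t))
        - M.ξ * (z t + ε * (v₂ t - z t)) ^ 2) (by linarith) (Real.exp_pos _).le
    linarith
  have hi1 := h.intervalIntegrable_saving hM
  have hi2 := (h.intervalIntegrable_savingVariation hM hv).const_mul ε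
  have hint := intervalIntegral.integral_mono_on hM.T_pos.le
    ((hi1.add hi2).sub intervalIntegrable_const) ((h.mix hv hε).intervalIntegrable_saving hM) hpt
  rw [intervalIntegral.integral_sub (hi1.add hi2) intervalIntegrable_const,
    intervalIntegral.integral_add hi1 hi2, intervalIntegral.integral_const_mul,
    intervalIntegral.integral_const, smul_eq_mul, sub_zero] at hint
  have := mul_le_mul_of_nonneg_left hint (Real.exp_pos (M.r * M.T)).le
  simp only [assets]
  linarith

theorem IsControl.integral_flowUtility_mix_ge (hM : M.StandingAssumptions) (h : M.IsControl c z)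
    (hv : M.IsControl v₁ v₂) {ε : ℝ} (hε : ε ∈ Icc (0 : ℝ) 1) :
    (∫ t in (0 : ℝ)..M.T, M.flowUtility c z t)
      + ε * ((∫ t in (0 : ℝ)..M.T, M.flowUtility v₁ v₂ t)
        - ∫ t in (0 : ℝ)..M.T, M.flowUtility c z t)
      ≤ ∫ t in (0 : ℝ)..M.T, M.flowUtility (fun t => c t + ε * (v₁ t - c t))
          (fun t => z t + ε * (v₂ t - z t)) t := by
  have hi1 := h.intervalIntegrable_flowUtility hM
  have hi2 := hv.intervalIntegrable_flowUtility hM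
  rw [← intervalIntegral.integral_sub hi2 hi1, ← intervalIntegral.integral_const_mul,
    ← intervalIntegral.integral_add hi1 ((hi2.sub hi1).const_mul ε)]
  refine intervalIntegral.integral_mono_on hM.T_pos.le (hi1.add ((hi2.sub hi1).const_mul ε))
    ((h.mix hv hε).intervalIntegrable_flowUtility hM) fun t ht => ?_
  have h1 : 0 < 1 - M.θ := by linarith [hM.θ_mem.2]
  have hconc := (Real.concaveOn_rpow h1.le (by linarith [hM.θ_mem.1] : 1 - M.θ ≤ 1)).2
    (h.c_mem t ht).1 (hv.c_mem t ht).1 (sub_nonneg.2 hε.2) hε.1 (by ring)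
  simp only [smul_eq_mul] at hconc
  have e1 : (1 - ε) * c t + ε * v₁ t = c t + ε * (v₁ t - c t) := by ring
  rw [e1] at hconc
  have hdiv := div_le_div_of_nonneg_right hconc h1.le
  have hz2 : (z t + ε * (v₂ t - z t)) ^ 2 ≤ z t ^ 2 + ε * (v₂ t ^ 2 - z t ^ 2) := by
    nlinarith [mul_nonneg (mul_nonneg hε.1 (sub_nonneg.2 hε.2)) (sq_nonneg (v₂ t - z t))]
  have hz3 := mul_le_mul_of_nonneg_left hz2 hM.η_pos.le
  simp only [flowUtility]
  have e2 : ((1 - ε) * c t ^ (1 - M.θ) + ε * v₁ t ^ (1 - M.θ)) / (1 - M.θ)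
    = c t ^ (1 - M.θ) / (1 - M.θ) + ε * (v₁ t ^ (1 - M.θ) / (1 - M.θ)
      - c t ^ (1 - M.θ) / (1 - M.θ)) := by ring
  rw [e2] at hdiv
  have hmain := mul_le_mul_of_nonneg_left (a := Real.exp (-(M.ρ * t)))
    (b := c t ^ (1 - M.θ) / (1 - M.θ) + ε * (v₁ t ^ (1 - M.θ) / (1 - M.θ)
      - c t ^ (1 - M.θ) / (1 - M.θ)) - M.η * (z t ^ 2 + ε * (v₂ t ^ 2 - z t ^ 2)))
    (c := (c t + ε * (v₁ t - c t)) ^ (1 - M.θ) / (1 - M.θ)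
      - M.η * (z t + ε * (v₂ t - z t)) ^ 2) (by linarith) (Real.exp_pos _).le
  linarith

/-- The gain in payoff along a segment of controls from an optimal pair. -/
theorem IsOptimal.exists_variation_le (hM : M.StandingAssumptions) (h : M.IsOptimal c z a x)
    (hv : M.IsControl v₁ v₂) :
    ∃ K, ∀ ε ∈ Icc (0 : ℝ) 1, ∀ A, A = a M.T
        + ε * (Real.exp (M.r * M.T) * ∫ t in (0 : ℝ)..M.T, M.savingVariation c z v₁ v₂ t)
        - K * ε ^ 2 → 0 ≤ A →
      ε * ((∫ t in (0 : ℝ)..M.T, M.flowUtility v₁ v₂ t)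
        - ∫ t in (0 : ℝ)..M.T, M.flowUtility c z t)
      + Real.exp (-(M.ρ * M.T)) * (A ^ (1 - M.θ) / (1 - M.θ))
      ≤ Real.exp (-(M.ρ * M.T)) * (a M.T ^ (1 - M.θ) / (1 - M.θ)) := by
  have hc := h.admissible.isControl
  obtain ⟨K, hK⟩ := hc.exists_assets_mix_ge hM hv
  refine ⟨K, fun ε hε A hA hA0 => ?_⟩
  have h1 := hK ε hε
  rw [h.admissible.assets_eq hM, ← hA] at h1
  -- Nonnegativity of the lower bound `A` is what makes the mixed control admissible.
  have h2 := h.payoff_le hM (hc.mix hv hε) (hA0.trans h1)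
  have h3 := hc.integral_flowUtility_mix_ge hM hv hε
  rw [payoff_eq_add, payoff_eq_add, h.admissible.assets_eq hM] at h2
  have h4 : 0 < 1 - M.θ := by linarith [hM.θ_mem.2]
  have h5 := mul_le_mul_of_nonneg_left (div_le_div_of_nonneg_right
    (Real.rpow_le_rpow hA0 h1 h4.le) h4.le) (Real.exp_pos (-(M.ρ * M.T))).le
  linarith

/-- At zero terminal assets, a first-order increase of order `ε` yields utility of order `ε ^ (1 -
θ)`, which outweighs any change of order `ε` in the running utility. -/
theorem IsOptimal.savingVariation_nonpos_of_eq_zero (hM : M.StandingAssumptions)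
    (h : M.IsOptimal c z a x) (ha : a M.T = 0) (hv : M.IsControl v₁ v₂) :
    ∫ t in (0 : ℝ)..M.T, M.savingVariation c z v₁ v₂ t ≤ 0 := by
  by_contra! hpos
  obtain ⟨K, hK⟩ := h.exists_variation_le hM hv
  set L := (∫ t in (0 : ℝ)..M.T, M.flowUtility v₁ v₂ t)
        - ∫ t in (0 : ℝ)..M.T, M.flowUtility c z t
  set Δ := Real.exp (M.r * M.T) * ∫ t in (0 : ℝ)..M.T, M.savingVariation c z v₁ v₂ t
  have hΔ : 0 < Δ := mul_pos (Real.exp_pos _) hpos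
  have hq : 0 < 1 - M.θ := by linarith [hM.θ_mem.2]
  set κ := Real.exp (-(M.ρ * M.T)) * ((Δ / 2) ^ (1 - M.θ) / (1 - M.θ))
  have hκ : 0 < κ := by
    have : 0 < Real.exp (-(M.ρ * M.T)) := Real.exp_pos _
    positivity
  -- After division by `ε ^ (1 - θ)`, optimality reads `κ ≤ -L * ε ^ θ`, whose right side tends to
  -- `0`.
  have hlim : Tendsto (fun ε : ℝ => -L * ε ^ M.θ) (𝓝[>] 0) (𝓝 (-L * 0 ^ M.θ)) :=
    (((Real.continuousAt_rpow_const 0 M.θ (Or.inr hM.θ_mem.1.le)).tendsto).const_mul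
      (-L)).mono_left nhdsWithin_le_nhds
  rw [Real.zero_rpow hM.θ_mem.1.ne', mul_zero] at hlim
  have hsmall : ∀ᶠ ε : ℝ in 𝓝[>] 0, K * ε ≤ Δ / 2 := by
    have h1 : Tendsto (fun ε : ℝ => K * ε) (𝓝[>] 0) (𝓝 (K * 0)) :=
      ((continuous_const.mul continuous_id).tendsto 0).mono_left nhdsWithin_le_nhds
    rw [mul_zero] at h1
    exact h1.eventually_le_const (half_pos hΔ)
  refine absurd (ge_of_tendsto hlim (b := κ) ?_) (not_le.2 hκ)
  filter_upwards [hsmall, Ioc_mem_nhdsGT (zero_lt_one (α := ℝ))] with ε hε hε1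
  have hε0 := hε1.1
  -- Half of the linear gain absorbs the quadratic error.
  have hA : ε * (Δ / 2) ≤ a M.T + ε * Δ - K * ε ^ 2 := by
    rw [ha]
    nlinarith [mul_le_mul_of_nonneg_left hε hε0.le]
  have hA0 : 0 ≤ ε * (Δ / 2) := by positivity
  have h1 := hK ε ⟨hε0.le, hε1.2⟩ _ rfl (hA0.trans hA)
  rw [show a M.T ^ (1 - M.θ) = 0 by rw [ha, Real.zero_rpow hq.ne'], zero_div, mul_zero] at h1
  have h2 := mul_le_mul_of_nonneg_left (div_le_div_of_nonneg_right
    (Real.rpow_le_rpow hA0 hA hq.le) hq.le) (Real.exp_pos (-(M.ρ * M.T))).le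
  have h3 : Real.exp (-(M.ρ * M.T)) * ((ε * (Δ / 2)) ^ (1 - M.θ) / (1 - M.θ))
      = κ * ε ^ (1 - M.θ) := by
    rw [Real.mul_rpow hε0.le (half_pos hΔ).le]; ring
  have h4 : ε ^ M.θ * ε ^ (1 - M.θ) = ε := by
    rw [← Real.rpow_add hε0]; simp
  have h5 : κ * ε ^ (1 - M.θ) ≤ (-L * ε ^ M.θ) * ε ^ (1 - M.θ) := by
    rw [mul_assoc (-L), h4]; linarith
  exact le_of_mul_le_mul_right h5 (Real.rpow_pos_of_pos hε0 _)

/-- First order condition at an optimal pair with positive terminal assets. -/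
theorem IsOptimal.first_order_condition (hM : M.StandingAssumptions)
    (h : M.IsOptimal c z a x) (ha : 0 < a M.T) (hv : M.IsControl v₁ v₂) :
    (∫ t in (0 : ℝ)..M.T, M.flowUtility v₁ v₂ t) - (∫ t in (0 : ℝ)..M.T, M.flowUtility c z t)
      + Real.exp ((M.r - M.ρ) * M.T) * a M.T ^ (-M.θ)
        * (∫ t in (0 : ℝ)..M.T, M.savingVariation c z v₁ v₂ t) ≤ 0 := by
  obtain ⟨K, hK⟩ := h.exists_variation_le hM hv
  set L := (∫ t in (0 : ℝ)..M.T, M.flowUtility v₁ v₂ t)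
        - ∫ t in (0 : ℝ)..M.T, M.flowUtility c z t
  set I := ∫ t in (0 : ℝ)..M.T, M.savingVariation c z v₁ v₂ t
  set Δ := Real.exp (M.r * M.T) * I with hΔ
  have hq : 0 < 1 - M.θ := by linarith [hM.θ_mem.2]
  have hin : HasDerivAt (fun ε : ℝ => a M.T + ε * Δ - K * ε ^ 2) Δ 0 := by
    have h1 : HasDerivAt (fun ε : ℝ => a M.T + ε * Δ) Δ 0 := by
      simpa using ((hasDerivAt_id (0 : ℝ)).mul_const Δ).const_add (a M.T)
    have h2 : HasDerivAt (fun ε : ℝ => K * ε ^ 2) 0 0 := by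
      simpa using (hasDerivAt_pow 2 (0 : ℝ)).const_mul K
    simpa using h1.fun_sub h2
  have hg : HasDerivAt (fun ε : ℝ => ε * L + Real.exp (-(M.ρ * M.T)) *
      ((a M.T + ε * Δ - K * ε ^ 2) ^ (1 - M.θ) / (1 - M.θ)))
      (L + Real.exp (-(M.ρ * M.T)) * (a M.T ^ (-M.θ) * Δ)) 0 := by
    have h1 := (((hin.rpow_const (p := 1 - M.θ) (Or.inl (by simpa using ha.ne'))).div_const
      (1 - M.θ)).const_mul (Real.exp (-(M.ρ * M.T))))
    have h2 : HasDerivAt (fun ε : ℝ => ε * L) L 0 := by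
      simpa using (hasDerivAt_id (0 : ℝ)).mul_const L
    refine (h2.add h1).congr_deriv ?_
    rw [show (1 - M.θ - 1) = -M.θ by ring]
    simp only [zero_mul, add_zero, ne_eq, OfNat.ofNat_ne_zero, not_false_eq_true, zero_pow,
      mul_zero, sub_zero]
    field_simp
  have hpos : ∀ᶠ ε : ℝ in 𝓝[>] 0, 0 ≤ a M.T + ε * Δ - K * ε ^ 2 := by
    have h1 := hin.continuousAt.tendsto.mono_left (nhdsWithin_le_nhds (s := Ioi 0))
    refine h1.eventually_const_le ?_
    simpa using ha
  -- The lower bound for the varied payoff agrees with the optimal payoff at `ε = 0` and does not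
  -- exceed it for small `ε > 0`, so its right derivative there is at most `0`.
  have hle := le_of_tendsto hg.tendsto_slope_zero_right (b := 0) (by
    filter_upwards [hpos, Ioc_mem_nhdsGT (zero_lt_one (α := ℝ))] with ε hε hε1
    have h1 := hK ε ⟨hε1.1.le, hε1.2⟩ _ rfl hε
    rw [smul_eq_mul, zero_add]
    refine mul_nonpos_of_nonneg_of_nonpos (inv_nonneg.2 hε1.1.le) ?_
    simp only [zero_mul, add_zero, ne_eq, OfNat.ofNat_ne_zero, not_false_eq_true, zero_pow,
      mul_zero, sub_zero, zero_add]
    linarith)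
  have he : Real.exp ((M.r - M.ρ) * M.T) = Real.exp (-(M.ρ * M.T)) * Real.exp (M.r * M.T) := by
    rw [← Real.exp_add]; congr 1; ring
  rw [he]
  calc _ = L + Real.exp (-(M.ρ * M.T)) * (a M.T ^ (-M.θ) * Δ) := by rw [hΔ]; ring
    _ ≤ 0 := hle

/-! ### Positivity of terminal assets -/

theorem isControl_zero_const (hM : M.StandingAssumptions) {σ : ℝ} (hσ : |σ| ≤ M.Z) :
    M.IsControl (fun _ => 0) (fun _ => σ) :=
  ⟨aemeasurable_const, aemeasurable_const, fun _ _ => ⟨le_rfl, hM.C_pos.le⟩, fun _ _ => hσ⟩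

theorem StandingAssumptions.w_nonneg (hM : M.StandingAssumptions) {y : ℝ}
    (hy : y ∈ Icc (0 : ℝ) 1) : 0 ≤ M.w y := by
  have hcl : closure (Ioo (0 : ℝ) 1) ⊆ {y | 0 ≤ M.w y} :=
    closure_minimal (fun y hy => (hM.w_pos y hy).le)
      (isClosed_le continuous_const hM.continuous_w)
  rw [closure_Ioo zero_ne_one] at hcl
  exact hcl hy

/-- Since `w > 0` on the open interval, a zero can only be an endpoint, where `w'` has a strict
sign. -/
theorem StandingAssumptions.deriv_w_ne_zero (hM : M.StandingAssumptions) {y : ℝ}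
    (hy : y ∈ Icc (0 : ℝ) 1) (hw : M.w y = 0) : deriv M.w y ≠ 0 := by
  rcases hy.1.eq_or_lt with h0 | h0
  · exact (hM.w_deriv_pos y h0.symm.le).ne'
  rcases hy.2.eq_or_lt with h1 | h1
  · exact (hM.w_deriv_neg y h1.symm.le).ne
  · exact absurd hw (hM.w_pos y ⟨h0, h1⟩).ne'

theorem location_zero (t : ℝ) : M.location (fun _ => 0) t = M.x₀ := by simp [location]

/-- For a slow constant move, the wage gain is linear in the speed and the moving cost quadratic. -/
theorem StandingAssumptions.exists_savingVariation_pos (hM : M.StandingAssumptions)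
    (hw : M.w M.x₀ = 0) : ∃ σ, |σ| ≤ M.Z ∧
      0 < ∫ t in (0 : ℝ)..M.T,
        M.savingVariation (fun _ => 0) (fun _ => 0) (fun _ => 0) (fun _ => σ) t := by
  set d := deriv M.w M.x₀
  have hd : d ≠ 0 := hM.deriv_w_ne_zero hM.x₀_mem hw
  set P := ∫ t in (0 : ℝ)..M.T, Real.exp (-(M.r * t)) * t
  set Q := ∫ t in (0 : ℝ)..M.T, Real.exp (-(M.r * t))
  have hP : 0 < P := by
    refine intervalIntegral.intervalIntegral_pos_of_pos_on
      (Continuous.intervalIntegrable (by fun_prop) _ _) (fun t ht => ?_) hM.T_pos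
    exact mul_pos (Real.exp_pos _) ht.1
  have hQ : 0 < Q := intervalIntegral.intervalIntegral_pos_of_pos_on
      (Continuous.intervalIntegrable (by fun_prop) _ _) (fun t _ => Real.exp_pos _) hM.T_pos
  have hval : ∀ σ : ℝ, ∫ t in (0 : ℝ)..M.T,
      M.savingVariation (fun _ => 0) (fun _ => 0) (fun _ => 0) (fun _ => σ) t
      = d * σ * P - M.ξ * σ ^ 2 * Q := by
    intro σ
    rw [← intervalIntegral.integral_const_mul, ← intervalIntegral.integral_const_mul,
      ← intervalIntegral.integral_sub (Continuous.intervalIntegrable (by fun_prop) _ _)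
        (Continuous.intervalIntegrable (by fun_prop) _ _)]
    refine intervalIntegral.integral_congr fun t _ => ?_
    simp only [savingVariation, location_zero, sub_zero, intervalIntegral.integral_const,
      smul_eq_mul, mul_zero, ne_eq, OfNat.ofNat_ne_zero, not_false_eq_true, zero_pow]
    ring
  have hZ := hM.Z_pos
  have hξ := hM.ξ_pos
  -- The first bound keeps `|δ * d| ≤ Z`; the second keeps the quadratic cost at most half of the
  -- linear gain.
  set δ := min (M.Z / |d|) (P / (2 * M.ξ * Q)) with hδ
  have hd' : 0 < |d| := abs_pos.2 hd
  have hδ0 : 0 < δ := lt_min (by positivity) (by positivity)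
  refine ⟨δ * d, ?_, ?_⟩
  · rw [abs_mul, abs_of_pos hδ0, ← le_div_iff₀ hd']
    exact min_le_left _ _
  · rw [hval]
    have h1 : δ * (2 * M.ξ * Q) ≤ P := by
      rw [← le_div_iff₀ (by positivity)]; exact min_le_right _ _
    have h2 : d * (δ * d) * P - M.ξ * (δ * d) ^ 2 * Q
        = δ * d ^ 2 * (P - δ * (2 * M.ξ * Q) / 2) := by ring
    rw [h2]
    have h3 : 0 < d ^ 2 := by positivity
    exact mul_pos (by positivity) (by linarith)

theorem payoff_zero_speed (hM : M.StandingAssumptions) :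
    M.payoff (fun _ => 0) (fun _ => 0) = Real.exp (-(M.ρ * M.T)) *
      (M.assets (fun _ => 0) (fun _ => 0) M.T ^ (1 - M.θ) / (1 - M.θ)) := by
  have hq : 1 - M.θ ≠ 0 := by linarith [hM.θ_mem.2]
  rw [payoff_eq_add]
  simp [flowUtility, Real.zero_rpow hq]

theorem assets_zero (hM : M.StandingAssumptions) :
    M.a₀ ≤ M.assets (fun _ => 0) (fun _ => 0) M.T ∧
      (M.w M.x₀ ≠ 0 → 0 < M.assets (fun _ => 0) (fun _ => 0) M.T) := by
  have hQ : 0 < ∫ t in (0 : ℝ)..M.T, Real.exp (-(M.r * t)) :=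
    intervalIntegral.intervalIntegral_pos_of_pos_on
      (Continuous.intervalIntegrable (by fun_prop) _ _) (fun t _ => Real.exp_pos _) hM.T_pos
  have hval : M.assets (fun _ => 0) (fun _ => 0) M.T = Real.exp (M.r * M.T) *
      (M.a₀ + (∫ t in (0 : ℝ)..M.T, Real.exp (-(M.r * t))) * M.w M.x₀) := by
    rw [assets, ← intervalIntegral.integral_mul_const]
    simp [saving, location_zero]
  have hw := hM.w_nonneg hM.x₀_mem
  have ha := hM.a₀_nonneg
  have he : 1 ≤ Real.exp (M.r * M.T) :=
    Real.one_le_exp (mul_nonneg hM.r_pos.le hM.T_pos.le)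
  rw [hval]
  constructor
  · nlinarith [mul_nonneg hQ.le hw, mul_nonneg (sub_nonneg.2 he) (add_nonneg ha
      (mul_nonneg hQ.le hw))]
  · intro hne
    have := mul_pos hQ (lt_of_le_of_ne hw hne.symm)
    positivity

theorem IsOptimal.terminal_assets_pos (hM : M.StandingAssumptions) (h : M.IsOptimal c z a x) :
    0 < a M.T := by
  refine lt_of_le_of_ne h.admissible.a_final fun ha => ?_
  have ha := ha.symm
  have hc := h.admissible.isControl
  have hq : 0 < 1 - M.θ := by linarith [hM.θ_mem.2]
  -- Dropping consumption while keeping the speed has first variation `∫ exp (-(r t)) p c ≥ 0`.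
  -- Being also nonpositive, it vanishes, so `c = 0` a.e.
  have hv : M.IsControl (fun _ => 0) z :=
    ⟨aemeasurable_const, hc.z_meas, fun _ _ => ⟨le_rfl, hM.C_pos.le⟩, hc.z_mem⟩
  have hvar := h.savingVariation_nonpos_of_eq_zero hM ha hv
  have hnn : 0 ≤ᵐ[volume.restrict (Ioc 0 M.T)] M.savingVariation c z (fun _ => 0) z := by
    refine (ae_restrict_iff' measurableSet_Ioc).2 (Eventually.of_forall fun t ht => ?_)
    have := (hc.c_mem t (Ioc_subset_Icc_self ht)).1
    have := hM.p_pos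
    simp only [savingVariation, sub_self, intervalIntegral.integral_zero, mul_zero, zero_sub,
      sub_zero, mul_neg, neg_neg, Pi.zero_apply]
    positivity
  have hzero := (intervalIntegral.integral_eq_zero_iff_of_le_of_nonneg_ae hM.T_pos.le hnn
    (hc.intervalIntegrable_savingVariation hM hv)).1
    (le_antisymm hvar (intervalIntegral.integral_nonneg_of_ae_restrict hM.T_pos.le (by
      rwa [← Measure.restrict_congr_set Ioc_ae_eq_Icc])))
  have hJ : M.payoff c z ≤ 0 := by
    rw [payoff_eq_add, h.admissible.assets_eq hM, ha, Real.zero_rpow hq.ne', zero_div, mul_zero,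
      add_zero]
    have hn : 0 ≤ ∫ t in (0 : ℝ)..M.T, -M.flowUtility c z t := by
      refine intervalIntegral.integral_nonneg_of_ae_restrict hM.T_pos.le ?_
      rw [← Measure.restrict_congr_set Ioc_ae_eq_Icc]
      filter_upwards [hzero] with t ht
      have hct : c t = 0 := by
        simpa [savingVariation, hM.p_pos.ne', (Real.exp_pos _).ne'] using ht
      have := hM.η_pos
      simp only [flowUtility, hct, Real.zero_rpow hq.ne', zero_div, zero_sub, mul_neg, neg_neg,
        Pi.zero_apply]
      positivity
    rw [intervalIntegral.integral_neg] at hn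
    linarith
  have h0 : M.IsControl (fun _ => 0) (fun _ => 0) :=
    isControl_zero_const hM (by simpa using hM.Z_pos.le)
  have hA0 : 0 ≤ M.assets (fun _ => 0) (fun _ => 0) M.T := hM.a₀_nonneg.trans (assets_zero hM).1
  have hJ0 := (h.payoff_le hM h0 hA0).trans hJ
  have hA : M.assets (fun _ => 0) (fun _ => 0) M.T = 0 := by
    by_contra hne
    have hpos : 0 < M.assets (fun _ => 0) (fun _ => 0) M.T := lt_of_le_of_ne hA0 (Ne.symm hne)
    rw [payoff_zero_speed hM] at hJ0
    have : 0 < Real.exp (-(M.ρ * M.T)) := Real.exp_pos _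
    exact absurd hJ0 (not_le.2 (by positivity))
  have hw : M.w M.x₀ = 0 := by
    by_contra hne
    exact ((assets_zero hM).2 hne).ne' hA
  -- The zero controls have payoff `0`, already the upper bound for the optimal payoff, so the
  -- zero-assets condition applies to them as well.
  have hopt : M.IsOptimal (fun _ => 0) (fun _ => 0) (M.assets (fun _ => 0) (fun _ => 0))
      (M.location (fun _ => 0)) := by
    refine ⟨h0.isAdmissible hM hA0, fun c' z' a' x' h' => ?_⟩
    have h1 := h.maximal c' z' a' x' h'
    rw [← h.admissible.payoff_eq hM] at h1
    change _ ≤ M.payoff _ _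
    rw [payoff_zero_speed hM, hA, Real.zero_rpow hq.ne']
    simpa using h1.trans hJ
  obtain ⟨σ, hσ, hpos⟩ := hM.exists_savingVariation_pos hw
  exact absurd (hopt.savingVariation_nonpos_of_eq_zero hM hA (isControl_zero_const hM hσ))
    (not_le.2 hpos)

/-! ### Explicit costates and existence of multipliers -/

/-- The location costate per unit of the initial asset costate. -/
noncomputable def unitCostate (M : RelocationModel) (x : ℝ → ℝ) (t : ℝ) : ℝ :=
  ∫ τ in t..M.T, deriv M.w (x τ) * Real.exp (-(M.r * τ))

/-- The relocation speed given by the costates. -/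
noncomputable def costateSpeed (M : RelocationModel) (x : ℝ → ℝ) (lam t : ℝ) : ℝ :=
  lam * M.unitCostate x t
    / (2 * (M.ξ * lam * Real.exp (-(M.r * t)) + M.η * Real.exp (-(M.ρ * t))))

/-- The consumption given by the costates. -/
noncomputable def costateConsumption (M : RelocationModel) (lam t : ℝ) : ℝ :=
  min M.C ((lam * M.p * Real.exp ((M.ρ - M.r) * t)) ^ (-(1 / M.θ)))

theorem IsAdmissible.continuousOn_x (hM : M.StandingAssumptions) (h : M.IsAdmissible c z a x) :
    ContinuousOn x (Icc 0 M.T) := by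
  simpa [uIcc_of_le hM.T_pos.le] using h.x_ac.continuousOn

theorem intervalIntegrable_deriv_w (hM : M.StandingAssumptions)
    (hx : ContinuousOn x (Icc 0 M.T)) :
    IntervalIntegrable (fun τ => deriv M.w (x τ) * Real.exp (-(M.r * τ))) volume 0 M.T := by
  refine ContinuousOn.intervalIntegrable ?_
  rw [uIcc_of_le hM.T_pos.le]
  exact (hM.continuous_deriv_w.comp_continuousOn hx).mul (by fun_prop)

theorem unitCostate_eq_neg : M.unitCostate x
    = fun t => -∫ τ in M.T..t, deriv M.w (x τ) * Real.exp (-(M.r * τ)) := by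
  funext t
  rw [unitCostate, intervalIntegral.integral_symm]

theorem absolutelyContinuous_unitCostate (hM : M.StandingAssumptions)
    (hx : ContinuousOn x (Icc 0 M.T)) :
    AbsolutelyContinuousOnInterval (M.unitCostate x) 0 M.T := by
  rw [unitCostate_eq_neg]
  exact ((intervalIntegrable_deriv_w hM hx).absolutelyContinuousOnInterval_intervalIntegral
    (by simp)).fun_neg

theorem continuousOn_unitCostate (hM : M.StandingAssumptions)
    (hx : ContinuousOn x (Icc 0 M.T)) : ContinuousOn (M.unitCostate x) (Icc 0 M.T) := by
  simpa [uIcc_of_le hM.T_pos.le] using (absolutelyContinuous_unitCostate hM hx).continuousOn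

theorem ae_hasDerivAt_unitCostate (hM : M.StandingAssumptions)
    (hx : ContinuousOn x (Icc 0 M.T)) :
    ∀ᵐ t ∂(volume.restrict (Icc 0 M.T)),
      HasDerivAt (M.unitCostate x) (-(deriv M.w (x t) * Real.exp (-(M.r * t)))) t := by
  rw [unitCostate_eq_neg]
  filter_upwards [ae_hasDerivAt_intervalIntegral hM.T_pos.le (intervalIntegrable_deriv_w hM hx)
    hM.T_mem] with t ht
  exact ht.fun_neg

theorem abs_unitCostate_le (hM : M.StandingAssumptions) {t : ℝ} (ht : t ∈ Icc 0 M.T) :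
    |M.unitCostate x t| ≤ M.T * ⨆ y, |deriv M.w y| := by
  have hS : 0 ≤ ⨆ y, |deriv M.w y| := (abs_nonneg _).trans (hM.abs_deriv_w_le 0)
  have hb : ∀ τ ∈ uIoc t M.T,
      ‖deriv M.w (x τ) * Real.exp (-(M.r * τ))‖ ≤ ⨆ y, |deriv M.w y| := by
    intro τ hτ
    rw [uIoc_of_le ht.2] at hτ
    rw [norm_mul, Real.norm_eq_abs, Real.norm_eq_abs, Real.abs_exp]
    have h1 : Real.exp (-(M.r * τ)) ≤ 1 :=
      Real.exp_le_one_iff.2 (neg_nonpos.2 (mul_nonneg hM.r_pos.le (ht.1.trans hτ.1.le)))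
    exact (mul_le_of_le_one_right (abs_nonneg _) h1).trans (hM.abs_deriv_w_le _)
  have h1 := intervalIntegral.norm_integral_le_of_norm_le_const hb
  rw [Real.norm_eq_abs, abs_of_nonneg (sub_nonneg.2 ht.2), mul_comm] at h1
  exact h1.trans (mul_le_mul_of_nonneg_right (by linarith [ht.1]) hS)

theorem costate_denominator_pos (hM : M.StandingAssumptions) {lam : ℝ} (hlam : 0 < lam) (t : ℝ) :
    0 < M.ξ * lam * Real.exp (-(M.r * t)) + M.η * Real.exp (-(M.ρ * t)) := by
  have := hM.ξ_pos
  have := hM.η_pos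
  positivity

theorem mul_unitCostate_eq (hM : M.StandingAssumptions) {lam : ℝ} (hlam : 0 < lam) (t : ℝ) :
    lam * M.unitCostate x t
      = 2 * (M.ξ * lam * Real.exp (-(M.r * t)) + M.η * Real.exp (-(M.ρ * t)))
        * M.costateSpeed x lam t := by
  rw [costateSpeed, mul_div_cancel₀]
  exact (mul_pos two_pos (costate_denominator_pos hM hlam t)).ne'

/-- Dropping the `η` term from the denominator and using `exp (-(r t)) ≥ exp (-(r T))` leaves
exactly the lower bound assumed for `Z`. -/
theorem abs_costateSpeed_lt (hM : M.StandingAssumptions) {lam : ℝ} (hlam : 0 < lam) {t : ℝ}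
    (ht : t ∈ Icc 0 M.T) : |M.costateSpeed x lam t| < M.Z := by
  have hD := costate_denominator_pos hM hlam t
  have hξ := hM.ξ_pos
  have hη := hM.η_pos
  have hT := hM.T_pos
  have hS : 0 ≤ ⨆ y, |deriv M.w y| := (abs_nonneg _).trans (hM.abs_deriv_w_le 0)
  refine lt_of_le_of_lt ?_ hM.Z_large
  rw [costateSpeed, abs_div, abs_of_pos (mul_pos two_pos hD), abs_mul, abs_of_pos hlam,
    div_le_div_iff₀ (mul_pos two_pos hD) (by positivity)]
  have hexp : Real.exp (M.r * M.T) * Real.exp (-(M.r * t)) ≥ 1 := by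
    rw [← Real.exp_add]
    exact Real.one_le_exp (by nlinarith [hM.r_pos, ht.2])
  have hB : 0 ≤ M.T * ⨆ y, |deriv M.w y| := by positivity
  have h3 : 0 ≤ Real.exp (M.r * M.T) * Real.exp (-(M.ρ * t)) := by positivity
  calc lam * |M.unitCostate x t| * (2 * M.ξ)
      ≤ lam * (M.T * ⨆ y, |deriv M.w y|) * (2 * M.ξ) := by
        gcongr
        exact abs_unitCostate_le hM ht
    _ = (M.T * ⨆ y, |deriv M.w y|) * (2 * (M.ξ * lam * 1 + 0)) := by ring
    _ ≤ (M.T * ⨆ y, |deriv M.w y|) * (2 * (M.ξ * lam * (Real.exp (M.r * M.T) *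
          Real.exp (-(M.r * t))) + M.η * (Real.exp (M.r * M.T) * Real.exp (-(M.ρ * t))))) := by
        gcongr
        positivity
    _ = _ := by ring

/-- The costates' controls maximize the normal Hamiltonian. -/
theorem hamiltonian_le (hM : M.StandingAssumptions) {lam : ℝ} (hlam : 0 < lam) (t A X : ℝ)
    {φ : ℝ} (hφ : φ ∈ Icc 0 M.C) (ψ : ℝ) :
    M.hamiltonian 1 t A X φ ψ (lam * Real.exp (-(M.r * t))) (lam * M.unitCostate x t)
      ≤ M.hamiltonian 1 t A X (M.costateConsumption lam t) (M.costateSpeed x lam t)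
          (lam * Real.exp (-(M.r * t))) (lam * M.unitCostate x t) := by
  have hD := costate_denominator_pos hM hlam t
  set D := M.ξ * lam * Real.exp (-(M.r * t)) + M.η * Real.exp (-(M.ρ * t)) with hDdef
  have hp := hM.p_pos
  -- This is the marginal cost of consumption after `exp (-(ρ t))` is factored out of the
  -- Hamiltonian.
  have hk : 0 < lam * M.p * Real.exp ((M.ρ - M.r) * t) := by positivity
  have h1 := mul_le_mul_of_nonneg_left (Real.rpow_div_le_of_min hM.θ_mem hM.C_pos hk hφ)
    (Real.exp_pos (-(M.ρ * t))).le
  rw [← costateConsumption] at h1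
  have he : Real.exp (-(M.ρ * t)) * Real.exp ((M.ρ - M.r) * t) = Real.exp (-(M.r * t)) := by
    rw [← Real.exp_add]; congr 1; ring
  have e1 : ∀ y : ℝ, Real.exp (-(M.ρ * t)) * (y ^ (1 - M.θ) / (1 - M.θ)
      - lam * M.p * Real.exp ((M.ρ - M.r) * t) * y)
      = Real.exp (-(M.ρ * t)) * (y ^ (1 - M.θ) / (1 - M.θ))
        - lam * Real.exp (-(M.r * t)) * (M.p * y) := by
    intro y
    linear_combination (-(lam * M.p * y)) * he
  rw [e1, e1] at h1
  have hs : lam * M.unitCostate x t = 2 * D * M.costateSpeed x lam t :=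
    mul_unitCostate_eq hM hlam t
  simp only [hamiltonian, hs]
  set s := M.costateSpeed x lam t
  -- The part of the Hamiltonian depending on `ψ` is `-D (ψ - s) ^ 2` up to a constant.
  have h2 : 0 ≤ D * (ψ - s) ^ 2 := by positivity
  have e2 : D * (ψ - s) ^ 2 = D * ψ ^ 2 - 2 * D * s * ψ + D * s ^ 2 := by ring
  rw [e2] at h2
  simp only [hDdef] at h2 ⊢
  linarith

/-- The pointwise maximizer is explicit, hence measurable without a selection theorem, and can serve
as a competitor. -/
theorem isControl_costate (hM : M.StandingAssumptions) {lam : ℝ} (hlam : 0 < lam)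
    (hx : ContinuousOn x (Icc 0 M.T)) :
    M.IsControl (M.costateConsumption lam) (M.costateSpeed x lam) where
  c_meas := by
    unfold costateConsumption
    fun_prop
  z_meas := by
    refine (ContinuousOn.div ((continuousOn_unitCostate hM hx).const_mul lam) (by fun_prop)
      fun t _ => ?_).aemeasurable measurableSet_Icc
    exact (mul_pos two_pos (costate_denominator_pos hM hlam t)).ne'
  c_mem t _ := by
    have := hM.p_pos
    exact ⟨le_min hM.C_pos.le (by positivity), min_le_left _ _⟩
  z_mem t ht := (abs_costateSpeed_lt hM hlam ht).le

/-- Integration by parts: the boundary terms vanish because the displacement is `0` at time `0` and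
the costate is `0` at time `T`. -/
theorem IsControl.integral_unitCostate_mul (hM : M.StandingAssumptions) (h : M.IsControl c z)
    (hv : M.IsControl v₁ v₂) (hx : ContinuousOn x (Icc 0 M.T)) :
    ∫ t in (0 : ℝ)..M.T, (M.unitCostate x t * (v₂ t - z t)
      - deriv M.w (x t) * Real.exp (-(M.r * t)) * ∫ τ in (0 : ℝ)..t, (v₂ τ - z τ)) = 0 := by
  have hi := (hv.intervalIntegrable_z hM).sub (h.intervalIntegrable_z hM)
  have hac := (absolutelyContinuous_unitCostate hM hx).fun_mul
    (hi.absolutelyContinuousOnInterval_intervalIntegral (c := 0) (by simp))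
  rw [hac.integral_eq_sub_of_ae_hasDerivAt hM.T_pos.le ?_ hM.zero_mem hM.T_mem]
  · simp [unitCostate]
  · filter_upwards [ae_hasDerivAt_unitCostate hM hx,
      ae_hasDerivAt_intervalIntegral hM.T_pos.le hi hM.zero_mem] with t h1 h2
    refine (h1.mul h2).congr_deriv ?_
    ring

/-- The first-order condition towards the pointwise maximizer bounds the integrated Hamiltonian gap
above by `0`, and the gap is nonnegative. -/
theorem IsOptimal.ae_hamiltonian_eq (hM : M.StandingAssumptions) (h : M.IsOptimal c z a x)
    {lam : ℝ} (hlam : lam = Real.exp ((M.r - M.ρ) * M.T) * a M.T ^ (-M.θ)) :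
    ∀ᵐ t ∂(volume.restrict (Icc 0 M.T)),
      M.hamiltonian 1 t (a t) (x t) (M.costateConsumption lam t) (M.costateSpeed x lam t)
          (lam * Real.exp (-(M.r * t))) (lam * M.unitCostate x t)
        = M.hamiltonian 1 t (a t) (x t) (c t) (z t)
          (lam * Real.exp (-(M.r * t))) (lam * M.unitCostate x t) := by
  have ha := h.terminal_assets_pos hM
  have hlam0 : 0 < lam := by rw [hlam]; positivity
  have hx := h.admissible.continuousOn_x hM
  have hc := h.admissible.isControl
  have hv := isControl_costate hM hlam0 hx
  have hfoc := h.first_order_condition hM ha hv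
  have hparts := hc.integral_unitCostate_mul hM hv hx
  rw [← hlam] at hfoc
  set v₁ := M.costateConsumption lam
  set v₂ := M.costateSpeed x lam
  set G : ℝ → ℝ := fun t => M.unitCostate x t * (v₂ t - z t)
      - deriv M.w (x t) * Real.exp (-(M.r * t)) * ∫ τ in (0 : ℝ)..t, (v₂ τ - z τ)
  have hG : IntervalIntegrable G volume 0 M.T := by
    refine (IntervalIntegrable.continuousOn_mul ((hv.intervalIntegrable_z hM).sub
      (h.admissible.isControl.intervalIntegrable_z hM)) ?_).sub
      ((intervalIntegrable_deriv_w hM hx).mul_continuousOn ?_)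
    · rw [uIcc_of_le hM.T_pos.le]; exact continuousOn_unitCostate hM hx
    · rw [uIcc_of_le hM.T_pos.le]; exact hc.continuousOn_displacement hM hv
  have hi1 := hv.intervalIntegrable_flowUtility hM
  have hi2 := hc.intervalIntegrable_flowUtility hM
  have hi3 := (hc.intervalIntegrable_savingVariation hM hv).const_mul lam
  have hi4 := hG.const_mul lam
  -- Adding `lam * G`, of zero integral, replaces the nonlocal displacement term by a costate times
  -- the change of speed, so `E` is a pointwise Hamiltonian difference.
  set E : ℝ → ℝ := fun t => M.flowUtility v₁ v₂ t - M.flowUtility c z t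
    + lam * M.savingVariation c z v₁ v₂ t + lam * G t
  have hE : IntervalIntegrable E volume 0 M.T := ((hi1.sub hi2).add hi3).add hi4
  have hEint : ∫ t in (0 : ℝ)..M.T, E t ≤ 0 := by
    rw [intervalIntegral.integral_add ((hi1.sub hi2).add hi3) hi4,
      intervalIntegral.integral_add (hi1.sub hi2) hi3, intervalIntegral.integral_sub hi1 hi2,
      intervalIntegral.integral_const_mul, intervalIntegral.integral_const_mul, hparts]
    linarith
  have hEeq : ∀ t ∈ Icc 0 M.T, E t =
      M.hamiltonian 1 t (a t) (x t) (v₁ t) (v₂ t)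
          (lam * Real.exp (-(M.r * t))) (lam * M.unitCostate x t)
        - M.hamiltonian 1 t (a t) (x t) (c t) (z t)
          (lam * Real.exp (-(M.r * t))) (lam * M.unitCostate x t) := by
    intro t ht
    simp only [E, G, flowUtility, savingVariation, hamiltonian, h.admissible.location_eq hM ht]
    ring
  have hnn : 0 ≤ᵐ[volume.restrict (Icc 0 M.T)] E := by
    refine (ae_restrict_iff' measurableSet_Icc).2 (Eventually.of_forall fun t ht => ?_)
    rw [Pi.zero_apply, hEeq t ht]
    exact sub_nonneg.2 (hamiltonian_le hM hlam0 t (a t) (x t) (hc.c_mem t ht) (z t))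
  have hzero : E =ᵐ[volume.restrict (Icc 0 M.T)] 0 := by
    have h0 := le_antisymm hEint
      (intervalIntegral.integral_nonneg_of_ae_restrict hM.T_pos.le hnn)
    rw [← Measure.restrict_congr_set Ioc_ae_eq_Icc] at hnn ⊢
    exact (intervalIntegral.integral_eq_zero_iff_of_le_of_nonneg_ae hM.T_pos.le hnn hE).1 h0
  filter_upwards [hzero, ae_restrict_mem measurableSet_Icc] with t h0 ht
  rw [hEeq t ht] at h0
  exact sub_eq_zero.1 h0

theorem IsOptimal.isMultiplier (hM : M.StandingAssumptions) (h : M.IsOptimal c z a x)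
    {lam : ℝ} (hlam : lam = Real.exp ((M.r - M.ρ) * M.T) * a M.T ^ (-M.θ)) :
    M.IsMultiplier c z a x 1 (fun t => lam * Real.exp (-(M.r * t)))
      (fun t => lam * M.unitCostate x t) where
  lam₀_mem := Or.inr rfl
  p₁_ac := absolutelyContinuousOnInterval_of_contDiff (by fun_prop)
  p₂_ac := (absolutelyContinuous_unitCostate hM (h.admissible.continuousOn_x hM)).const_mul lam
  p₁_deriv := Eventually.of_forall fun t => by
    have h2 : HasDerivAt (fun t : ℝ => Real.exp (-(M.r * t)))
        (Real.exp (-(M.r * t)) * (-M.r)) t := by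
      simpa using ((hasDerivAt_id t).const_mul M.r).neg.exp
    exact (h2.const_mul lam).congr_deriv (by ring)
  p₂_deriv := by
    filter_upwards [ae_hasDerivAt_unitCostate hM (h.admissible.continuousOn_x hM)] with t ht
    exact (ht.const_mul lam).congr_deriv (by ring)
  max_cond := by
    have hlam0 : 0 < lam := by
      have := h.terminal_assets_pos hM
      rw [hlam]; positivity
    filter_upwards [h.ae_hamiltonian_eq hM hlam] with t ht φ hφ ψ _
    rw [← ht]
    exact hamiltonian_le hM hlam0 t (a t) (x t) hφ ψ
  p₁_final := by
    rw [hlam, one_mul, mul_right_comm, ← Real.exp_add]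
    congr 2; ring
  p₂_final := by simp [unitCostate]
  nontrivial := fun h0 => one_ne_zero h0.1

/-! ### Arbitrary multipliers -/

variable {lam₀ : ℝ} {p₁ p₂ : ℝ → ℝ}

theorem IsMultiplier.p₁_eq (hM : M.StandingAssumptions)
    (h : M.IsMultiplier c z a x lam₀ p₁ p₂) {t : ℝ} (ht : t ∈ Icc 0 M.T) :
    p₁ t = p₁ 0 * Real.exp (-(M.r * t)) := by
  have h2 : AbsolutelyContinuousOnInterval (fun t : ℝ => Real.exp (M.r * t)) 0 M.T :=
    absolutelyContinuousOnInterval_of_contDiff (by fun_prop)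
  have hd : ∀ᵐ t ∂(volume.restrict (Icc 0 M.T)),
      HasDerivAt (fun t => Real.exp (M.r * t) * p₁ t) ((fun _ => (0 : ℝ)) t) t := by
    filter_upwards [h.p₁_deriv] with t ht
    have h2 : HasDerivAt (fun t : ℝ => Real.exp (M.r * t)) (Real.exp (M.r * t) * M.r) t := by
      simpa using ((hasDerivAt_id t).const_mul M.r).exp
    refine (h2.mul ht).congr_deriv ?_
    ring
  have h3 := (h2.fun_mul h.p₁_ac).integral_eq_sub_of_ae_hasDerivAt hM.T_pos.le hd hM.zero_mem ht
  simp only [intervalIntegral.integral_zero, mul_zero, Real.exp_zero, one_mul] at h3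
  have he : Real.exp (M.r * t) * Real.exp (-(M.r * t)) = 1 := by
    rw [← Real.exp_add]; simp
  linear_combination (-Real.exp (-(M.r * t))) * h3 - p₁ t * he

theorem IsMultiplier.p₂_eq (hM : M.StandingAssumptions)
    (h : M.IsMultiplier c z a x lam₀ p₁ p₂) {t : ℝ} (ht : t ∈ Icc 0 M.T) :
    p₂ t = p₁ 0 * M.unitCostate x t := by
  have h1 := h.p₂_ac.integral_eq_sub_of_ae_hasDerivAt hM.T_pos.le h.p₂_deriv ht hM.T_mem
  rw [h.p₂_final, zero_sub, intervalIntegral.integral_neg, neg_inj] at h1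
  rw [← h1, unitCostate, ← intervalIntegral.integral_const_mul]
  refine intervalIntegral.integral_congr fun τ hτ => ?_
  rw [uIcc_of_le ht.2] at hτ
  simp only [h.p₁_eq hM ⟨ht.1.trans hτ.1, hτ.2⟩]
  ring

/-- In the abnormal case transversality gives `p₁(T) = 0`. Then `p₁` vanishes identically, hence so
does `p₂`, against nontriviality. -/
theorem IsMultiplier.lam₀_eq_one (hM : M.StandingAssumptions)
    (h : M.IsMultiplier c z a x lam₀ p₁ p₂) : lam₀ = 1 := by
  refine h.lam₀_mem.resolve_left fun h0 => h.nontrivial ⟨h0, ?_⟩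
  have hp : p₁ 0 = 0 := by
    have h1 := h.p₁_final
    rw [h.p₁_eq hM hM.T_mem, h0, zero_mul] at h1
    exact (mul_eq_zero.1 h1).resolve_right (Real.exp_pos _).ne'
  intro t ht
  rw [h.p₁_eq hM ht, h.p₂_eq hM ht, hp]
  simp

theorem IsMultiplier.p₁_zero_eq (hM : M.StandingAssumptions)
    (h : M.IsMultiplier c z a x lam₀ p₁ p₂) :
    p₁ 0 = Real.exp ((M.r - M.ρ) * M.T) * a M.T ^ (-M.θ) := by
  have h1 := h.p₁_final
  rw [h.p₁_eq hM hM.T_mem, h.lam₀_eq_one hM, one_mul] at h1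
  have he : Real.exp (M.r * M.T) * Real.exp (-(M.r * M.T)) = 1 := by
    rw [← Real.exp_add]; simp
  have he' : Real.exp ((M.r - M.ρ) * M.T) = Real.exp (M.r * M.T) * Real.exp (-(M.ρ * M.T)) := by
    rw [← Real.exp_add]; congr 1; ring
  rw [he']
  linear_combination Real.exp (M.r * M.T) * h1 - p₁ 0 * he

/-- The maximum condition determines the relocation speed. -/
theorem IsMultiplier.ae_speed_eq (hM : M.StandingAssumptions)
    (h : M.IsMultiplier c z a x lam₀ p₁ p₂) (hc : M.IsControl c z) (hp : 0 < p₁ 0) :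
    ∀ᵐ t ∂(volume.restrict (Icc 0 M.T)), z t = M.costateSpeed x (p₁ 0) t := by
  filter_upwards [h.max_cond, ae_restrict_mem measurableSet_Icc] with t hmax ht
  have hD := costate_denominator_pos hM hp t
  have hs := abs_le.1 (abs_costateSpeed_lt (x := x) hM hp ht).le
  -- Testing with the actual consumption cancels everything but the speed terms, and completing the
  -- square leaves `D (z - s) ^ 2 ≤ 0`.
  have h1 := hmax (c t) (hc.c_mem t ht) (M.costateSpeed x (p₁ 0) t) hs
  simp only [hamiltonian, h.lam₀_eq_one hM, h.p₁_eq hM ht, h.p₂_eq hM ht,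
    mul_unitCostate_eq hM hp t] at h1
  set s := M.costateSpeed x (p₁ 0) t
  have h2 : (M.ξ * p₁ 0 * Real.exp (-(M.r * t)) + M.η * Real.exp (-(M.ρ * t))) * (z t - s) ^ 2
      ≤ 0 := by linarith
  have h3 : (z t - s) ^ 2 ≤ 0 := nonpos_of_mul_nonpos_right h2 hD
  exact sub_eq_zero.1 (pow_eq_zero_iff two_ne_zero |>.1 (le_antisymm h3 (sq_nonneg _)))

end RelocationModel

theorem mainTheorem4 (M : RelocationModel) (hM : M.StandingAssumptions)
    (c z a x : ℝ → ℝ) (hopt : M.IsOptimal c z a x) :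
    0 < a M.T ∧
    (∃ (lam₀ : ℝ) (p₁ p₂ : ℝ → ℝ), M.IsMultiplier c z a x lam₀ p₁ p₂) ∧
    ∀ (lam₀ : ℝ) (p₁ p₂ : ℝ → ℝ), M.IsMultiplier c z a x lam₀ p₁ p₂ →
      ∀ lam₁ : ℝ, lam₁ = p₁ 0 →
        0 < lam₁ ∧
        lam₁ = Real.exp ((M.r - M.ρ) * M.T) * a M.T ^ (-M.θ) ∧
        (∀ t ∈ Set.Icc 0 M.T,
          p₂ t = lam₁ * ∫ τ in t..M.T, deriv M.w (x τ) * Real.exp (-(M.r * τ))) ∧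
        (∀ᵐ t ∂(MeasureTheory.volume.restrict (Set.Icc 0 M.T)),
          |z t| < M.Z ∧
          z t = p₂ t / (2 * (M.ξ * lam₁ * Real.exp (-(M.r * t))
            + M.η * Real.exp (-(M.ρ * t))))) ∧
        (∀ t ∈ Set.Icc 0 M.T,
          |p₂ t / (2 * (M.ξ * lam₁ * Real.exp (-(M.r * t))
            + M.η * Real.exp (-(M.ρ * t))))| < M.Z) := by
  have ha := hopt.terminal_assets_pos hM
  refine ⟨ha, ⟨_, _, _, hopt.isMultiplier hM rfl⟩, fun lam₀ p₁ p₂ h lam₁ hlam => ?_⟩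
  have hval := h.p₁_zero_eq hM
  have hpos : 0 < p₁ 0 := by rw [hval]; positivity
  subst hlam
  have hspeed : ∀ t ∈ Set.Icc 0 M.T, p₂ t / (2 * (M.ξ * p₁ 0 * Real.exp (-(M.r * t))
      + M.η * Real.exp (-(M.ρ * t)))) = M.costateSpeed x (p₁ 0) t := fun t ht => by
    rw [h.p₂_eq hM ht, RelocationModel.costateSpeed]
  refine ⟨hpos, hval, fun t ht => h.p₂_eq hM ht, ?_, fun t ht => ?_⟩
  · filter_upwards [h.ae_speed_eq hM hopt.admissible.isControl hpos,
      ae_restrict_mem measurableSet_Icc] with t hz ht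
    rw [hspeed t ht, hz]
    exact ⟨RelocationModel.abs_costateSpeed_lt hM hpos ht, rfl⟩
  · rw [hspeed t ht]
    exact RelocationModel.abs_costateSpeed_lt hM hpos ht
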